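/- Let $\Sigma=\mathbb{H}^2/\Gamma$ be a closed oriented hyperbolic surface, where $\Gamma\cong\pi_1(\Sigma)$ acts on $\mathbb{H}^2$ freely, properly discontinuously and cocompactly by orientation-preserving isometries, and let $\Delta$ be a (finite) triangulation of $\Sigma$ with a single vertex (triangles may be glued to themselves along sides and corners), all of whose edges are essential simple closed curves. A wall is a connected component of the preimage in $\mathbb{H}^2$ of an edge of $\Delta$ (the vertex being included in the edge). Call a topologically embedded path $L:[0,\infty)\to\mathbb{H}^2$ admissible if each intersection of $L$ with a wall is transverse, $L$ meets each wall in at most one point, and $L$ meets infinitely many walls. Here transverse means that if $L(t)\in w$ with $t>0$, then just before and just after time $t$ the path lies in different components of $\mathbb{H}^2\setminus w$; nothing is required at $t=0$. Identify $\mathbb{H}^2$ with the unit disc by the Cayley transform $z\mapsto (z-i)/(z+i)$ of the upper half-plane, and its circle at infinity with $S^1$. Let $D\subset\mathbb{H}^2$ be a bounded fundamental domain for the action of $\Gamma$ (the $\Gamma$-translates of $\overline D$ cover $\mathbb{H}^2$, and distinct translates of $D$ have disjoint interiors). For each $\varepsilon>0$ there is a compact set $K\subset\mathbb{H}^2$ so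 that the following holds. Suppose that $L_1,L_2:[0,\infty)\to\mathbb{H}^2$ are admissible paths which intersect $D$, say $L_1(s_1)\in D$ and $L_2(s_2)\in D$, and that for each wall $w$ which intersects $K$, the path $L_1$ intersects $w$ at some time $t\ge s_1$ if and only if $L_2$ intersects $w$ at some time $t\ge s_2$. (For paths starting in $D$ one may take $s_1=s_2=0$, and then this says that $L_1$ intersects $w$ if and only if $L_2$ does.) Then $L_1(t)$ and $L_2(t)$ converge in the closed disc, as $t\to\infty$, to points $\xi_1,\xi_2\in S^1$, and $\xi_1,\xi_2$ have distance at most $\varepsilon$ in the angular metric on $S^1$. -/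

import Mathlib

open scoped UpperHalfPlane NNReal Topology

/-- `Γ` is the group of deck transformations of a closed orientable hyperbolic surface
`ℍ / Γ`: it acts on the hyperbolic plane by orientation preserving isometries, properly
discontinuously, cocompactly and freely (an element of `SL(2, ℝ)` counts only through its action,
so that `-1` may belong to `Γ`). -/
structure IsClosedSurfaceGroup (Γ : Subgroup (Matrix.SpecialLinearGroup (Fin 2) ℝ)) : Prop where
  properlyDiscontinuous : ProperlyDiscontinuousSMul Γ ℍ
  cocompact : CompactSpace (Quotient (MulAction.orbitRel Γ ℍ))
  free : ∀ γ : Γ, (∃ z : ℍ, γ • z = z) → ∀ z : ℍ, γ • z = z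

/-- The hyperbolic surface `ℍ / Γ`. -/
abbrev HypSurface (Γ : Subgroup (Matrix.SpecialLinearGroup (Fin 2) ℝ)) : Type :=
  Quotient (MulAction.orbitRel Γ ℍ)

/-- The covering projection `ℍ → ℍ / Γ`. -/
noncomputable def HypSurface.proj (Γ : Subgroup (Matrix.SpecialLinearGroup (Fin 2) ℝ)) (z : ℍ) : HypSurface Γ :=
  Quotient.mk (MulAction.orbitRel Γ ℍ) z

/-- A (finite) triangulation of `X` with exactly one vertex: a space obtained from triangles by
gluing their sides in such a way that all corners become one point. Every edge is a loop at the
vertex, every triangle is a map of the standard simplex whose three sides run along edges (in one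
of the two directions), and every point of `X` is either the vertex, or lies in exactly one open
edge, or in exactly one open triangle, at exactly one parameter. -/
structure OneVertexTriangulation (X : Type*) [TopologicalSpace X] where
  vertex : X
  numEdges : ℕ
  numTriangles : ℕ
  edge : Fin numEdges → Path vertex vertex
  triangle : Fin numTriangles → C(stdSimplex ℝ (Fin 3), X)
  edge_injective : ∀ i j, ∀ s ∈ Set.Ioo (0 : unitInterval) 1, ∀ t ∈ Set.Ioo (0 : unitInterval) 1,
    edge i s = edge j t → i = j ∧ s = t
  edge_ne_vertex : ∀ i, ∀ s ∈ Set.Ioo (0 : unitInterval) 1, edge i s ≠ vertex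
  triangle_injective : ∀ k l (p q : stdSimplex ℝ (Fin 3)),
    (∀ a, 0 < (p : Fin 3 → ℝ) a) → (∀ a, 0 < (q : Fin 3 → ℝ) a) →
    triangle k p = triangle l q → k = l ∧ p = q
  triangle_notMem_edge : ∀ k (p : stdSimplex ℝ (Fin 3)), (∀ a, 0 < (p : Fin 3 → ℝ) a) →
    ∀ i, triangle k p ∉ Set.range (edge i)
  /-- The side opposite to the corner `a` has the corners `a + 1` and `a + 2` (modulo 3). -/
  side : ∀ k (a : Fin 3), ∃ i,
    (∀ p : stdSimplex ℝ (Fin 3), (p : Fin 3 → ℝ) a = 0 →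
      triangle k p = (edge i).extend ((p : Fin 3 → ℝ) (a + 1))) ∨
    (∀ p : stdSimplex ℝ (Fin 3), (p : Fin 3 → ℝ) a = 0 →
      triangle k p = (edge i).extend ((p : Fin 3 → ℝ) (a + 2)))
  cover : ∀ x : X, x = vertex ∨ (∃ i, x ∈ Set.range (edge i)) ∨
    ∃ k, x ∈ Set.range (triangle k)

/-- All edges are essential, i.e. no edge is a null-homotopic loop. (They are simple closed
curves by the definition of a triangulation.) -/
def OneVertexTriangulation.EdgesEssential {X : Type*} [TopologicalSpace X]
    (T : OneVertexTriangulation X) : Prop :=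
  ∀ i, ¬ Path.Homotopic (T.edge i) (Path.refl T.vertex)

/-- The walls: the connected components of the preimages in `ℍ` of the (closed) edges. -/
def walls {Γ : Subgroup (Matrix.SpecialLinearGroup (Fin 2) ℝ)}
    (T : OneVertexTriangulation (HypSurface Γ)) : Set (Set ℍ) :=
  {w | ∃ i, ∃ z ∈ HypSurface.proj Γ ⁻¹' Set.range (T.edge i),
    w = connectedComponentIn (HypSurface.proj Γ ⁻¹' Set.range (T.edge i)) z}

/-- `L` crosses `w` transversely at time `t`: just before and just after `t` it is in
different components of the complement of `w`. At the initial time `0` of the ray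
this is no condition. -/
def CrossesAt (L : ℝ≥0 → ℍ) (w : Set ℍ) (t : ℝ≥0) : Prop :=
  ∀ᶠ s in 𝓝[<] t, ∀ᶠ u in 𝓝[>] t, L s ∉ w ∧ L u ∉ w ∧
    connectedComponentIn wᶜ (L s) ≠ connectedComponentIn wᶜ (L u)

/-- An embedded ray which meets every wall transversely and at most once, and which meets
infinitely many walls. -/
structure IsWallTransverseRay {Γ : Subgroup (Matrix.SpecialLinearGroup (Fin 2) ℝ)}
    (T : OneVertexTriangulation (HypSurface Γ)) (L : ℝ≥0 → ℍ) : Prop where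
  embedded : Topology.IsEmbedding L
  transverse : ∀ w ∈ walls T, ∀ t, L t ∈ w → CrossesAt L w t
  once : ∀ w ∈ walls T, ∀ s t, L s ∈ w → L t ∈ w → s = t
  infinite : {w ∈ walls T | ∃ t, L t ∈ w}.Infinite

/-- `D` is a bounded fundamental domain for the action of `Γ` on `ℍ`: the translates of
its closure cover `ℍ`, and distinct translates have disjoint interiors. (An open, a closed or a
half-open fundamental polygon all qualify.) -/
structure IsBoundedFundamentalDomain (Γ : Subgroup (Matrix.SpecialLinearGroup (Fin 2) ℝ))
    (D : Set ℍ) : Prop where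
  bounded : Bornology.IsBounded D
  cover : ∀ z : ℍ, ∃ γ : Γ, γ • z ∈ closure D
  disjoint : ∀ γ : Γ, (∃ z : ℍ, γ • z ≠ z) →
    Disjoint (interior D) ((fun z : ℍ => γ • z) '' interior D)

/-- The Cayley transform, which identifies `ℍ` with the Poincare disc. -/
noncomputable def toDisc (z : ℍ) : ℂ := ((z : ℂ) - Complex.I) / ((z : ℂ) + Complex.I)

/-- The ray `L` ends at the point `ξ` of the circle at infinity: it converges to `ξ` in the
closed unit disc. -/
def HasEndpoint (L : ℝ≥0 → ℍ) (ξ : Circle) : Prop :=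
  Filter.Tendsto (fun t => toDisc (L t)) Filter.atTop (𝓝 (ξ : ℂ))

/-- The angular metric on the unit circle, with values in `[0, π]`. -/
noncomputable def angularDist (ξ η : Circle) : ℝ := |Complex.arg ((ξ : ℂ) / (η : ℂ))|

/-!
A wall is an orbit of a compact arc under a cyclic subgroup of `Γ`. Either this orbit is bounded, or
the subgroup is conjugate to a group of dilations and the wall stays close to a geodesic. Hence a
wall far away from the base point lies in a small cap of the disc, cut off by a chord. A ray crosses
such a wall only once, so that it can never leave the cap again. Since the regions between the walls
have bounded diameter, a ray meets a wall outside of any given finite set within a distance that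
depends only on the size of the set. So two rays that meet the same walls in a large ball are
trapped in a common small cap.
-/

open Set Filter Metric
open scoped Pointwise MatrixGroups

/-- A subset `W` of a metric space has a coarse projection with error `c` if every point `p` has a
coarse foot point `q` in `W`: going from `p` to a point of `W` through `q` is a detour of length at
most `c`. Quasi-convex subsets of hyperbolic spaces have this property. -/
def HasCoarseProjection {X : Type*} [PseudoMetricSpace X] (W : Set X) (c : ℝ) : Prop :=
  ∀ p, ∃ q ∈ W, ∀ x ∈ W, dist p q + dist q x ≤ dist p x + c

namespace HasCoarseProjection

variable {X Y : Type*} [PseudoMetricSpace X] [PseudoMetricSpace Y] {A W : Set X} {c r : ℝ}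

theorem mono {c' : ℝ} (h : HasCoarseProjection W c) (hc : c ≤ c') : HasCoarseProjection W c' :=
  fun p ↦ let ⟨q, hq, hle⟩ := h p
  ⟨q, hq, fun x hx ↦ (hle x hx).trans (by gcongr)⟩

theorem image (h : HasCoarseProjection W c) (φ : X ≃ᵢ Y) : HasCoarseProjection (φ '' W) c := by
  intro p
  obtain ⟨q, hq, hle⟩ := h (φ.symm p)
  refine ⟨φ q, mem_image_of_mem φ hq, forall_mem_image.2 fun x hx ↦ ?_⟩
  simpa only [← φ.dist_eq (φ.symm p), ← φ.dist_eq q, φ.apply_symm_apply] using hle x hx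

theorem of_dist_le (hA : HasCoarseProjection A c) (hAW : ∀ a ∈ A, ∃ x ∈ W, dist a x ≤ r)
    (hWA : ∀ x ∈ W, ∃ a ∈ A, dist a x ≤ r) : HasCoarseProjection W (c + 4 * r) := by
  intro p
  obtain ⟨a, ha, hle⟩ := hA p
  obtain ⟨q, hq, haq⟩ := hAW a ha
  refine ⟨q, hq, fun x hx ↦ ?_⟩
  obtain ⟨b, hb, hbx⟩ := hWA x hx
  linarith [hle b hb, dist_triangle p a q, dist_triangle4 q a b x, dist_triangle_right p b x,
    dist_comm q a]

theorem exists_of_isBounded (hne : W.Nonempty) (hW : Bornology.IsBounded W) :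
    ∃ c, HasCoarseProjection W c := by
  obtain ⟨q, hq⟩ := hne
  obtain ⟨r, hr⟩ := hW.subset_closedBall q
  refine ⟨2 * r, fun p ↦ ⟨q, hq, fun x hx ↦ ?_⟩⟩
  linarith [dist_triangle_right p q x, dist_comm q x, mem_closedBall.1 (hr hx)]

end HasCoarseProjection

/-- The union of the translates of `C` by the powers of `g`. -/
def cyclicOrbit {G X : Type*} [Group G] [MulAction G X] (g : G) (C : Set X) : Set X :=
  ⋃ n : ℤ, g ^ n • C

section CyclicOrbit

variable {G H X Y : Type*} [Group G] [MulAction G X] [Group H] [MulAction H Y]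

theorem map_zpow_smul {g : G} {h : H} {φ : X → Y} (hφ : ∀ x, φ (g • x) = h • φ x) (n : ℤ) (x : X) :
    φ (g ^ n • x) = h ^ n • φ x := by
  induction n generalizing x with
  | zero => simp only [zpow_zero, one_smul]
  | succ n ih => rw [zpow_add_one, zpow_add_one, mul_smul, mul_smul, ih, hφ]
  | pred n ih =>
    have hφ_inv : φ (g⁻¹ • x) = h⁻¹ • φ x := by rw [eq_inv_smul_iff, ← hφ, smul_inv_smul]
    rw [zpow_sub_one, zpow_sub_one, mul_smul, mul_smul, ih, hφ_inv]

theorem image_cyclicOrbit {g : G} {h : H} {φ : X → Y} (hφ : ∀ x, φ (g • x) = h • φ x)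
    (C : Set X) : φ '' cyclicOrbit g C = cyclicOrbit h (φ '' C) := by
  simp only [cyclicOrbit, image_iUnion, ← image_smul, image_image, map_zpow_smul hφ]

theorem smul_cyclicOrbit (k g : G) (C : Set X) :
    k • cyclicOrbit g C = ⋃ n : ℤ, (k * g ^ n) • C := by
  simp only [cyclicOrbit, smul_set_iUnion, mul_smul]

theorem cyclicOrbit_eq_of_smul_eq {g : G} {C : Set X} (hg : g • C = C) : cyclicOrbit g C = C := by
  have zpow_smul_eq (n : ℤ) : g ^ n • C = C :=
    zpow_mem (MulAction.mem_stabilizer_iff.2 hg : g ∈ MulAction.stabilizer G C) n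
  simp only [cyclicOrbit, zpow_smul_eq, iUnion_const]

end CyclicOrbit

section Dilation

theorem half_exp_le_cosh (x : ℝ) : Real.exp x / 2 ≤ Real.cosh x := by
  rw [Real.cosh_eq]
  linarith [Real.exp_pos (-x)]

theorem add_le_of_cosh_eq_mul {a b d : ℝ} (hd : 0 ≤ d)
    (h : Real.cosh d = Real.cosh a * Real.cosh b) : a + b ≤ d + Real.log 4 := by
  have cosh_le_exp : Real.cosh d ≤ Real.exp d := by
    rw [← Real.cosh_add_sinh]
    linarith [Real.sinh_nonneg_iff.2 hd]
  rw [← Real.exp_le_exp, Real.exp_add, Real.exp_add, Real.exp_log (by norm_num)]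
  have := mul_le_mul (half_exp_le_cosh a) (half_exp_le_cosh b) (by positivity) (by positivity)
  linarith

/-- Hyperbolic Pythagoras: the foot of the perpendicular from `p` to the imaginary axis is the
point `q` of the same modulus. -/
theorem cosh_dist_eq_mul_of_re_eq_zero {p q w : ℍ} (hq : q.re = 0) (hqp : q.im = ‖(p : ℂ)‖)
    (hw : w.re = 0) : Real.cosh (dist p w) = Real.cosh (dist p q) * Real.cosh (dist q w) := by
  have sq_im : q.im ^ 2 = p.re ^ 2 + p.im ^ 2 := by
    rw [hqp, Complex.sq_norm, Complex.normSq_apply, UpperHalfPlane.coe_re, UpperHalfPlane.coe_im,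
      sq, sq]
  have := p.im_pos
  have := q.im_pos
  have := w.im_pos
  simp only [UpperHalfPlane.cosh_dist', hq, hw]
  field_simp
  rw [sq_im]
  ring

theorem hasCoarseProjection_imaginaryAxis :
    HasCoarseProjection {z : ℍ | z.re = 0} (Real.log 4) := by
  intro p
  let q : ℍ := ⟨⟨0, ‖(p : ℂ)‖⟩, norm_pos_iff.2 p.ne_zero⟩
  exact ⟨q, rfl, fun w hw ↦
    add_le_of_cosh_eq_mul dist_nonneg (cosh_dist_eq_mul_of_re_eq_zero rfl rfl hw)⟩

theorem exists_dist_zpow_smul_I_le {u : {x : ℝ // 0 < x}} (hu : u ≠ 1) {z : ℍ} (hz : z.re = 0) :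
    ∃ n : ℤ, dist z (u ^ n • UpperHalfPlane.I) ≤ |Real.log u| := by
  have log_ne_zero : Real.log u ≠ 0 :=
    Real.log_ne_zero_of_pos_of_ne_one u.2 fun h ↦ hu (Subtype.ext h)
  refine ⟨⌊Real.log z.im / Real.log u⌋, ?_⟩
  rw [UpperHalfPlane.dist_of_re_eq (by simp [hz]), Real.dist_eq, UpperHalfPlane.pos_real_im,
    UpperHalfPlane.I_im, mul_one, Positive.coe_zpow, Real.log_zpow]
  calc |Real.log z.im - ⌊Real.log z.im / Real.log u⌋ * Real.log u|
      = |Int.fract (Real.log z.im / Real.log u)| * |Real.log u| := by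
        rw [← abs_mul, Int.fract, sub_mul, div_mul_cancel₀ _ log_ne_zero]
    _ ≤ |Real.log u| := by
        rw [Int.abs_fract]
        exact mul_le_of_le_one_left (abs_nonneg _) (Int.fract_lt_one _).le

theorem exists_hasCoarseProjection_cyclicOrbit_dilation {u : {x : ℝ // 0 < x}} (hu : u ≠ 1)
    {C : Set ℍ} (hne : C.Nonempty) (hC : Bornology.IsBounded C) :
    ∃ c, HasCoarseProjection (cyclicOrbit u C) c := by
  obtain ⟨R, hR⟩ := hC.subset_closedBall UpperHalfPlane.I
  have dist_zpow_smul_le (n : ℤ) {x : ℍ} (hx : x ∈ C) :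
      dist (u ^ n • UpperHalfPlane.I) (u ^ n • x) ≤ R := by
    rw [(UpperHalfPlane.isometry_pos_mul (u ^ n)).dist_eq, dist_comm]
    exact hR hx
  refine ⟨_, hasCoarseProjection_imaginaryAxis.of_dist_le (r := |Real.log u| + R) ?_ ?_⟩
  · intro z hz
    obtain ⟨n, hn⟩ := exists_dist_zpow_smul_I_le hu hz
    obtain ⟨x, hx⟩ := hne
    exact ⟨u ^ n • x, mem_iUnion.2 ⟨n, smul_mem_smul_set hx⟩,
      (dist_triangle ..).trans (add_le_add hn (dist_zpow_smul_le n hx))⟩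
  · intro z hz
    obtain ⟨n, x, hx, rfl⟩ := mem_iUnion.1 hz
    exact ⟨u ^ n • UpperHalfPlane.I, by simp,
      (dist_zpow_smul_le n hx).trans (le_add_of_nonneg_left (abs_nonneg _))⟩

theorem exists_dist_vadd_lt (v : ℝ) {δ : ℝ} (hδ : 0 < δ) : ∃ z : ℍ, dist z (v +ᵥ z) < δ := by
  have tendsto_div : Tendsto (fun t : ℝ ↦ |v| / t) atTop (𝓝 0) :=
    tendsto_const_nhds.div_atTop tendsto_id
  obtain ⟨t, htδ, ht⟩ := ((tendsto_div.eventually_lt_const hδ).and (eventually_gt_atTop 0)).exists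
  refine ⟨⟨⟨0, t⟩, ht⟩, (UpperHalfPlane.dist_le_dist_coe_div_sqrt _ _).trans_lt ?_⟩
  rwa [UpperHalfPlane.vadd_im, UpperHalfPlane.mk_im, Real.sqrt_mul_self ht.le, Complex.dist_eq,
    UpperHalfPlane.coe_vadd, sub_add_cancel_right, norm_neg, Complex.norm_real, Real.norm_eq_abs]

/-- The conjugating isometry moves the finite fixed point `v / (1 - u)` of `z ↦ u z + v` to `0`. -/
theorem exists_conj_dilation_of_apply_one_zero_eq_zero {g : SL(2, ℝ)} (hg : g 1 0 = 0) {δ : ℝ}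
    (hδ : 0 < δ) (hdisp : ∀ z : ℍ, δ ≤ dist z (g • z)) :
    ∃ (φ : ℍ ≃ᵢ ℍ) (u : {x : ℝ // 0 < x}), u ≠ 1 ∧ ∀ z, φ (g • z) = u • φ z := by
  obtain ⟨u, v, huv⟩ := UpperHalfPlane.exists_SL2_smul_eq_of_apply_zero_one_eq_zero g hg
  replace huv (z : ℍ) : g • z = v +ᵥ u • z := congrFun huv z
  have u_ne_one : u ≠ 1 := by
    rintro rfl
    obtain ⟨z, hz⟩ := exists_dist_vadd_lt v hδ
    exact absurd (hdisp z) (by rw [huv, one_smul]; exact hz.not_ge)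
  have one_sub_ne_zero : (1 : ℝ) - u ≠ 0 := sub_ne_zero.2 fun h ↦ u_ne_one (Subtype.ext h.symm)
  refine ⟨⟨AddAction.toPerm (-(v / (1 - u))), UpperHalfPlane.isometry_real_vadd _⟩, u, u_ne_one,
    fun z ↦ ?_⟩
  change -(v / (1 - u) : ℝ) +ᵥ g • z = u • (-(v / (1 - u) : ℝ) +ᵥ z)
  rw [huv]
  apply UpperHalfPlane.ext_re_im
  · simp only [UpperHalfPlane.vadd_re, UpperHalfPlane.pos_real_re]
    field_simp
    ring
  · simp only [UpperHalfPlane.vadd_im, UpperHalfPlane.pos_real_im]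

theorem exists_smul_eq_self_of_sq_trace_lt_four {g : SL(2, ℝ)} (hg : g.1.trace ^ 2 < 4) :
    ∃ z : ℍ, g • z = z := by
  set G := Matrix.SpecialLinearGroup.mapGL ℝ g
  have det_eq_one : (G : Matrix (Fin 2) (Fin 2) ℝ).det = 1 := by simp [G]
  have isElliptic : G.IsElliptic := by
    change Matrix.discr _ < 0
    rw [Matrix.discr_fin_two, det_eq_one]
    simpa [G] using hg
  exact ⟨UpperHalfPlane.fixedPt G isElliptic,
    (UpperHalfPlane.gl_smul_eq_self_iff_eq_fixedPt (by simp [G]) isElliptic).2 rfl⟩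

/-- The matrix `!![0, -1; 1, -x]` moves a real fixed point `x` of `g` to infinity. -/
theorem exists_conj_apply_one_zero_eq_zero {g : SL(2, ℝ)} (hg : 4 ≤ g.1.trace ^ 2) :
    ∃ B : SL(2, ℝ), (B * g * B⁻¹) 1 0 = 0 := by
  by_cases hc : g 1 0 = 0
  · exact ⟨1, by simpa using hc⟩
  have det_eq_one : g 0 0 * g 1 1 - g 0 1 * g 1 0 = 1 := by rw [← Matrix.det_fin_two, g.det_coe]
  obtain ⟨x, hx⟩ : ∃ x : ℝ, g 1 0 * x ^ 2 + (g 1 1 - g 0 0) * x - g 0 1 = 0 := by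
    rw [Matrix.trace_fin_two, ← sub_nonneg] at hg
    refine ⟨(g 0 0 - g 1 1 + √((g 0 0 + g 1 1) ^ 2 - 4)) / (2 * g 1 0), ?_⟩
    have sq_sqrt := Real.sq_sqrt hg
    field_simp
    linear_combination sq_sqrt + 4 * det_eq_one
  let B : SL(2, ℝ) := ⟨!![0, -1; 1, -x], by simp [Matrix.det_fin_two]⟩
  refine ⟨B, ?_⟩
  rw [Matrix.SpecialLinearGroup.coe_mul, Matrix.SpecialLinearGroup.coe_mul,
    Matrix.SpecialLinearGroup.coe_inv, Matrix.adjugate_fin_two]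
  simp only [B, Matrix.mul_apply, Fin.sum_univ_two, Matrix.of_apply, Matrix.cons_val',
    Matrix.cons_val]
  linear_combination hx

theorem exists_conj_dilation {g : SL(2, ℝ)} {δ : ℝ} (hδ : 0 < δ)
    (hdisp : ∀ z : ℍ, δ ≤ dist z (g • z)) :
    ∃ (φ : ℍ ≃ᵢ ℍ) (u : {x : ℝ // 0 < x}), u ≠ 1 ∧ ∀ z, φ (g • z) = u • φ z := by
  have four_le_sq_trace : 4 ≤ g.1.trace ^ 2 := by
    by_contra! hlt
    obtain ⟨z, hz⟩ := exists_smul_eq_self_of_sq_trace_lt_four hlt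
    linarith [hz ▸ hdisp z, dist_self z]
  obtain ⟨B, hB⟩ := exists_conj_apply_one_zero_eq_zero four_le_sq_trace
  obtain ⟨φ, u, hu, hφ⟩ := exists_conj_dilation_of_apply_one_zero_eq_zero hB hδ fun z ↦ by
    calc δ ≤ dist (B⁻¹ • z) (g • B⁻¹ • z) := hdisp _
      _ = dist z ((B * g * B⁻¹) • z) := by
        rw [← dist_smul B, smul_inv_smul, smul_smul, smul_smul]
  refine ⟨(IsometryEquiv.constSMul B).trans φ, u, hu, fun z ↦ ?_⟩
  have := hφ (B • z)
  rwa [smul_smul, inv_mul_cancel_right, mul_smul] at this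

theorem exists_hasCoarseProjection_cyclicOrbit {g : SL(2, ℝ)} {δ : ℝ} (hδ : 0 < δ)
    (hdisp : ∀ z : ℍ, δ ≤ dist z (g • z)) {C : Set ℍ} (hne : C.Nonempty)
    (hC : Bornology.IsBounded C) : ∃ c, HasCoarseProjection (cyclicOrbit g C) c := by
  obtain ⟨φ, u, hu, hφ⟩ := exists_conj_dilation hδ hdisp
  obtain ⟨c, hc⟩ := exists_hasCoarseProjection_cyclicOrbit_dilation hu (hne.image φ)
    (φ.isometry.lipschitz.isBounded_image hC)
  rw [← image_cyclicOrbit hφ] at hc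
  refine ⟨c, ?_⟩
  simpa only [← image_comp, φ.symm_comp_self, image_id] using hc.image φ.symm

end Dilation

section Disc

theorem coe_add_I_ne_zero (z : ℍ) : (z : ℂ) + Complex.I ≠ 0 := by
  intro h
  have im_add_one : z.im + 1 = 0 := congrArg Complex.im h
  linarith [z.im_pos]

theorem continuous_toDisc : Continuous toDisc :=
  (UpperHalfPlane.continuous_coe.sub continuous_const).div
    (UpperHalfPlane.continuous_coe.add continuous_const) coe_add_I_ne_zero

theorem norm_toDisc (z : ℍ) : ‖toDisc z‖ = Real.tanh (dist z UpperHalfPlane.I / 2) := by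
  rw [UpperHalfPlane.tanh_half_dist, Complex.dist_eq, Complex.dist_eq, UpperHalfPlane.coe_I,
    Complex.conj_I, sub_neg_eq_add, toDisc, norm_div]

theorem norm_toDisc_lt_one (z : ℍ) : ‖toDisc z‖ < 1 :=
  (norm_toDisc z).trans_lt (Real.tanh_lt_one _)

theorem one_sub_le_norm_toDisc (z : ℍ) :
    1 - 2 * Real.exp (-dist z UpperHalfPlane.I) ≤ ‖toDisc z‖ := by
  set d := dist z UpperHalfPlane.I
  have cosh_pos := Real.cosh_pos (d / 2)
  rw [norm_toDisc, Real.tanh_eq_sinh_div_cosh, le_div_iff₀ cosh_pos, sub_mul, one_mul,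
    sub_le_comm, Real.cosh_sub_sinh]
  calc Real.exp (-(d / 2)) = 2 * Real.exp (-d) * (Real.exp (d / 2) / 2) := by
        rw [show -(d / 2) = -d + d / 2 by ring, Real.exp_add]
        ring
    _ ≤ 2 * Real.exp (-d) * Real.cosh (d / 2) := by gcongr; exact half_exp_le_cosh _

theorem norm_coe_add_I (z : ℍ) :
    ‖(z : ℂ) + Complex.I‖ = Real.cosh (dist z UpperHalfPlane.I / 2) * (2 * √z.im) := by
  have sqrt_im_ne_zero : √z.im ≠ 0 := (Real.sqrt_pos.2 z.im_pos).ne'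
  rw [UpperHalfPlane.cosh_half_dist, Complex.dist_eq, UpperHalfPlane.I_im, mul_one,
    UpperHalfPlane.coe_I, Complex.conj_I, sub_neg_eq_add]
  field_simp

theorem norm_toDisc_sub (z w : ℍ) : ‖toDisc z - toDisc w‖ = Real.sinh (dist z w / 2) /
    (Real.cosh (dist z UpperHalfPlane.I / 2) * Real.cosh (dist w UpperHalfPlane.I / 2)) := by
  have toDisc_sub : toDisc z - toDisc w =
      2 * Complex.I * (z - w) / ((z + Complex.I) * (w + Complex.I)) := by
    have := coe_add_I_ne_zero z
    have := coe_add_I_ne_zero w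
    unfold toDisc
    field_simp
    ring
  have := Real.sqrt_pos.2 z.im_pos
  have := Real.sqrt_pos.2 w.im_pos
  have := Real.cosh_pos (dist z UpperHalfPlane.I / 2)
  have := Real.cosh_pos (dist w UpperHalfPlane.I / 2)
  rw [toDisc_sub, norm_div, norm_mul, norm_mul, norm_mul, norm_coe_add_I, norm_coe_add_I,
    UpperHalfPlane.sinh_half_dist, Complex.dist_eq, Real.sqrt_mul z.im_pos.le, Complex.norm_I,
    Complex.norm_ofNat]
  field_simp

theorem norm_toDisc_sub_le (z w : ℍ) : ‖toDisc z - toDisc w‖ ≤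
    2 * Real.exp ((dist z w - dist z UpperHalfPlane.I - dist w UpperHalfPlane.I) / 2) := by
  set a := dist z UpperHalfPlane.I
  set b := dist w UpperHalfPlane.I
  rw [norm_toDisc_sub, div_le_iff₀ (by positivity)]
  calc Real.sinh (dist z w / 2) ≤ Real.exp (dist z w / 2) / 2 := by
        rw [Real.sinh_eq]
        linarith [Real.exp_pos (-(dist z w / 2))]
    _ = 2 * Real.exp ((dist z w - a - b) / 2) *
        (Real.exp (a / 2) / 2 * (Real.exp (b / 2) / 2)) := by
        rw [show dist z w / 2 = (dist z w - a - b) / 2 + a / 2 + b / 2 by ring, Real.exp_add,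
          Real.exp_add]
        ring
    _ ≤ 2 * Real.exp ((dist z w - a - b) / 2) * (Real.cosh (a / 2) * Real.cosh (b / 2)) := by
        gcongr <;> exact half_exp_le_cosh _

/-- The inverse of `toDisc`, with junk values outside of the open unit disc. -/
noncomputable def fromDisc (w : ℂ) : ℍ :=
  UpperHalfPlane.ofComplex (Complex.I * (1 + w) / (1 - w))

theorem one_sub_ne_zero_of_norm_lt_one {w : ℂ} (hw : ‖w‖ < 1) : 1 - w ≠ 0 :=
  sub_ne_zero.2 (by rintro rfl; exact hw.ne norm_one)

theorem coe_fromDisc {w : ℂ} (hw : ‖w‖ < 1) :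
    (fromDisc w : ℂ) = Complex.I * (1 + w) / (1 - w) := by
  have im_eq : (Complex.I * (1 + w) / (1 - w)).im = (1 - ‖w‖ ^ 2) / Complex.normSq (1 - w) := by
    rw [Complex.div_im, ← sub_div, Complex.sq_norm]
    simp only [Complex.normSq_apply, Complex.mul_im, Complex.mul_re, Complex.add_re, Complex.add_im,
      Complex.sub_re, Complex.sub_im, Complex.I_re, Complex.I_im, Complex.one_re, Complex.one_im]
    ring
  have normSq_pos := Complex.normSq_pos.2 (one_sub_ne_zero_of_norm_lt_one hw)
  have sq_norm_lt_one : ‖w‖ ^ 2 < 1 := pow_lt_one₀ (norm_nonneg w) hw two_ne_zero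
  rw [fromDisc, UpperHalfPlane.ofComplex_apply_of_im_pos]
  rw [im_eq]
  exact div_pos (sub_pos.2 sq_norm_lt_one) normSq_pos

theorem toDisc_fromDisc {w : ℂ} (hw : ‖w‖ < 1) : toDisc (fromDisc w) = w := by
  have := one_sub_ne_zero_of_norm_lt_one hw
  rw [toDisc, div_eq_iff (coe_add_I_ne_zero _), coe_fromDisc hw]
  field_simp
  ring

theorem fromDisc_toDisc (z : ℍ) : fromDisc (toDisc z) = z := by
  have := coe_add_I_ne_zero z
  apply UpperHalfPlane.ext
  rw [coe_fromDisc (norm_toDisc_lt_one z),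
    div_eq_iff (one_sub_ne_zero_of_norm_lt_one (norm_toDisc_lt_one z)), toDisc]
  field_simp
  ring

theorem continuousOn_fromDisc : ContinuousOn fromDisc (ball 0 1) := by
  rw [UpperHalfPlane.isEmbedding_coe.continuousOn_iff]
  refine ContinuousOn.congr (f := fun w ↦ Complex.I * (1 + w) / (1 - w)) ?_
    fun w hw ↦ coe_fromDisc (mem_ball_zero_iff.1 hw)
  exact ContinuousOn.div (by fun_prop) (by fun_prop)
    fun w hw ↦ one_sub_ne_zero_of_norm_lt_one (mem_ball_zero_iff.1 hw)

theorem fromDisc_image_ball_inter (S : Set ℂ) : fromDisc '' (ball 0 1 ∩ S) = toDisc ⁻¹' S := by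
  ext z
  constructor
  · rintro ⟨w, ⟨hw, hwS⟩, rfl⟩
    rwa [mem_preimage, toDisc_fromDisc (mem_ball_zero_iff.1 hw)]
  · exact fun hz ↦ ⟨toDisc z, ⟨mem_ball_zero_iff.2 (norm_toDisc_lt_one z), hz⟩, fromDisc_toDisc z⟩

/-- The part of the hyperbolic plane which `toDisc` maps to the half-plane `{w | c ≤ ⟪u, w⟫}`. For
a unit vector `u` and `c` close to `1` it is a neighbourhood of `u` at infinity that looks small
from the center of the disc. -/
def discCap (u : ℂ) (c : ℝ) : Set ℍ := {z | c ≤ inner ℝ u (toDisc z)}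

theorem discCap_subset_discCap (u : ℂ) {c c' : ℝ} (h : c' ≤ c) : discCap u c ⊆ discCap u c' :=
  fun _ hz ↦ h.trans hz

theorem le_norm_toDisc_of_mem_discCap {u : ℂ} (hu : ‖u‖ = 1) {c : ℝ} {z : ℍ}
    (hz : z ∈ discCap u c) : c ≤ ‖toDisc z‖ := by
  simpa only [hu, one_mul] using le_trans hz (real_inner_le_norm u (toDisc z))

theorem isPreconnected_compl_discCap (u : ℂ) (c : ℝ) : IsPreconnected (discCap u c)ᶜ := by
  have compl_eq : (discCap u c)ᶜ = toDisc ⁻¹' {w | inner ℝ u w < c} := by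
    ext z
    exact not_le (a := c)
  rw [compl_eq, ← fromDisc_image_ball_inter]
  have convex : Convex ℝ {w : ℂ | inner ℝ u w < c} :=
    convex_halfSpace_lt (innerₛₗ ℝ u).isLinear c
  exact ((convex_ball 0 1).inter convex).isPreconnected.image _
    (continuousOn_fromDisc.mono inter_subset_left)

theorem norm_toDisc_sub_sq_le {u : ℂ} (hu : ‖u‖ = 1) {η : ℝ} {z : ℍ}
    (hz : z ∈ discCap u (1 - η)) : ‖toDisc z - u‖ ^ 2 ≤ 2 * η := by
  have sq_norm_le_one : ‖toDisc z‖ ^ 2 ≤ 1 :=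
    pow_le_one₀ (norm_nonneg _) (norm_toDisc_lt_one z).le
  have le_inner : 1 - η ≤ inner ℝ u (toDisc z) := hz
  rw [norm_sub_sq_real, real_inner_comm, hu]
  linarith

theorem exists_subset_discCap_of_forall_dist_add_dist_le {W : Set ℍ} {q : ℍ} {c : ℝ}
    (hq : q ≠ UpperHalfPlane.I)
    (hW : ∀ x ∈ W, dist UpperHalfPlane.I q + dist q x ≤ dist UpperHalfPlane.I x + c) :
    ∃ u : ℂ, ‖u‖ = 1 ∧ W ⊆
      discCap u (1 - (2 + 2 * Real.exp (c / 2)) * Real.exp (-dist q UpperHalfPlane.I)) := by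
  set d := dist q UpperHalfPlane.I
  have norm_q_pos : 0 < ‖toDisc q‖ := by
    rw [norm_toDisc, Real.tanh_eq_sinh_div_cosh]
    exact div_pos (Real.sinh_pos_iff.2 (half_pos (dist_pos.2 hq))) (Real.cosh_pos _)
  set u := ‖toDisc q‖⁻¹ • toDisc q
  have norm_u : ‖u‖ = 1 := by rw [norm_smul, norm_inv, norm_norm, inv_mul_cancel₀ norm_q_pos.ne']
  have inner_q : inner ℝ u (toDisc q) = ‖toDisc q‖ := by
    rw [real_inner_smul_left, real_inner_self_eq_norm_sq, sq, inv_mul_cancel_left₀ norm_q_pos.ne']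
  refine ⟨u, norm_u, fun x hx ↦ ?_⟩
  have inner_le : inner ℝ u (toDisc q - toDisc x) ≤ ‖toDisc x - toDisc q‖ := by
    simpa only [norm_u, one_mul, norm_sub_rev] using
      real_inner_le_norm u (toDisc q - toDisc x)
  have exp_le : Real.exp ((dist x q - dist x UpperHalfPlane.I - d) / 2) ≤
      Real.exp (c / 2) * Real.exp (-d) := by
    rw [← Real.exp_add, Real.exp_le_exp]
    linarith [hW x hx, dist_comm q UpperHalfPlane.I, dist_comm x UpperHalfPlane.I, dist_comm x q]
  rw [inner_sub_right, inner_q] at inner_le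
  change 1 - (2 + 2 * Real.exp (c / 2)) * Real.exp (-d) ≤ inner ℝ u (toDisc x)
  linarith [norm_toDisc_sub_le x q, one_sub_le_norm_toDisc q]

theorem exists_subset_discCap (c : ℝ) {η : ℝ} (hη : 0 < η) :
    ∃ N : ℝ, ∀ W : Set ℍ, HasCoarseProjection W c → Disjoint W (closedBall UpperHalfPlane.I N) →
      ∃ u : ℂ, ‖u‖ = 1 ∧ W ⊆ discCap u (1 - η) := by
  set k := 2 + 2 * Real.exp (c / 2)
  have tendsto_error : Tendsto (fun N : ℝ ↦ k * Real.exp (-N)) atTop (𝓝 0) := by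
    simpa only [mul_zero] using Real.tendsto_exp_neg_atTop_nhds_zero.const_mul k
  obtain ⟨N, hN, N_nonneg⟩ :=
    ((tendsto_error.eventually_lt_const hη).and (eventually_ge_atTop 0)).exists
  refine ⟨N, fun W hW hdisj ↦ ?_⟩
  obtain ⟨q, hq, hle⟩ := hW UpperHalfPlane.I
  have lt_dist : N < dist q UpperHalfPlane.I :=
    not_le.1 fun h ↦ disjoint_left.1 hdisj hq (mem_closedBall.2 h)
  obtain ⟨u, norm_u, hu⟩ := exists_subset_discCap_of_forall_dist_add_dist_le
    (dist_pos.1 (N_nonneg.trans_lt lt_dist)) hle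
  refine ⟨u, norm_u, hu.trans (discCap_subset_discCap u (sub_le_sub_left ?_ 1))⟩
  calc k * Real.exp (-dist q UpperHalfPlane.I) ≤ k * Real.exp (-N) := by gcongr
    _ ≤ η := hN.le

end Disc

theorem subset_biUnion_of_isPreconnected_of_locallyFinite {X ι : Type*} [TopologicalSpace X]
    {f : ι → Set X} {S : Set X} {J : Set ι} (hf : LocallyFinite f) (hclosed : ∀ i, IsClosed (f i))
    (hS : IsPreconnected S) (hcover : S ⊆ ⋃ i, f i)
    (hJ : ∀ i ∈ J, ∀ j, (S ∩ (f i ∩ f j)).Nonempty → j ∈ J) (hne : ∃ i ∈ J, (S ∩ f i).Nonempty) :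
    S ⊆ ⋃ i ∈ J, f i := by
  have isClosed_biUnion (I : Set ι) : IsClosed (⋃ i ∈ I, f i) := by
    rw [biUnion_eq_iUnion]
    exact (hf.comp_injective Subtype.val_injective).isClosed_iUnion fun i ↦ hclosed i
  have disjoint : S ∩ ((⋃ i ∈ J, f i) ∩ ⋃ i ∈ Jᶜ, f i) = ∅ := by
    refine eq_empty_of_forall_notMem fun x ⟨hxS, hxJ, hxJc⟩ ↦ ?_
    obtain ⟨i, hi, hxi⟩ := mem_iUnion₂.1 hxJ
    obtain ⟨j, hj, hxj⟩ := mem_iUnion₂.1 hxJc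
    exact hj (hJ i hi j ⟨x, hxS, hxi, hxj⟩)
  have cover : S ⊆ (⋃ i ∈ J, f i) ∪ ⋃ i ∈ Jᶜ, f i := by
    rwa [← biUnion_union, union_compl_self, biUnion_univ]
  refine (isPreconnected_iff_subset_of_disjoint_closed.1 hS _ _ (isClosed_biUnion J)
    (isClosed_biUnion Jᶜ) cover disjoint).resolve_right fun hsub ↦ ?_
  obtain ⟨i, hi, x, hxS, hxi⟩ := hne
  exact disjoint.subset ⟨hxS, mem_biUnion hi hxi, hsub hxS⟩

theorem subset_of_isPreconnected_of_locallyFinite {X ι : Type*} [TopologicalSpace X]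
    {f : ι → Set X} {S : Set X} (hf : LocallyFinite f) (hclosed : ∀ i, IsClosed (f i))
    (hS : IsPreconnected S) (hcover : S ⊆ ⋃ i, f i)
    (hinter : ∀ i j, (S ∩ (f i ∩ f j)).Nonempty → f i = f j) {i : ι} (hi : (S ∩ f i).Nonempty) :
    S ⊆ f i :=
  (subset_biUnion_of_isPreconnected_of_locallyFinite (J := {j | f j = f i}) hf hclosed hS hcover
    (fun j hj k hjk ↦ (hinter j k hjk).symm.trans hj) ⟨i, rfl, hi⟩).trans
    (iUnion₂_subset fun _ hj ↦ hj.subset)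

section GroupAction

variable {G X : Type*} [Group G] [MulAction G X]

theorem smul_set_eq_smul_set_of_smul_eq_smul
    (hfree : ∀ g : G, (∃ x : X, g • x = x) → ∀ x : X, g • x = x) {g h : G} {x : X}
    (hx : g • x = h • x) (C : Set X) : g • C = h • C := by
  have fixes (y : X) : (h⁻¹ * g) • y = y :=
    hfree _ ⟨x, by rw [mul_smul, hx, inv_smul_smul]⟩ y
  refine image_congr fun y _ ↦ ?_
  rw [← inv_smul_eq_iff, ← mul_smul, fixes]

variable [TopologicalSpace X]

theorem locallyFinite_smul_set [WeaklyLocallyCompactSpace X] [ProperlyDiscontinuousSMul G X]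
    {ι : Type*} [Finite ι] {C : ι → Set X} (hC : ∀ i, IsCompact (C i)) :
    LocallyFinite fun p : ι × G ↦ p.2 • C p.1 := fun x ↦ by
  obtain ⟨K, hK, hKx⟩ := exists_compact_mem_nhds x
  have finite (i : ι) : {g : G | (g • C i ∩ K).Nonempty}.Finite :=
    ProperlyDiscontinuousSMul.finite_disjoint_inter_image (hC i) hK
  refine ⟨K, hKx, (finite_iUnion fun i ↦ (finite i).image (Prod.mk i)).subset ?_⟩
  rintro ⟨i, g⟩ hne
  exact mem_iUnion.2 ⟨i, mem_image_of_mem _ hne⟩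

variable [ContinuousConstSMul G X]

theorem connectedComponentIn_iUnion_smul {C : Set X} {g : G} (hclosed : IsClosed C)
    (hC : IsPreconnected C) (hne : (C ∩ g • C).Nonempty) (hlf : LocallyFinite fun h : G ↦ h • C)
    (hoverlap : ∀ h : G, (C ∩ h • C).Nonempty → ∃ n : ℤ, h • C = g ^ n • C) {k : G} {x : X}
    (hx : x ∈ k • C) : connectedComponentIn (⋃ h : G, h • C) x = k • cyclicOrbit g C := by
  have isPreconnected_smul (h : G) : IsPreconnected (h • C) :=
    hC.image _ (continuous_const_smul h).continuousOn
  rw [smul_cyclicOrbit]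
  apply Subset.antisymm
  · have overlap_mem : ∀ h ∈ {h : G | ∃ n : ℤ, h • C = (k * g ^ n) • C}, ∀ h' : G,
        (connectedComponentIn (⋃ h : G, h • C) x ∩ (h • C ∩ h' • C)).Nonempty →
        ∃ n : ℤ, h' • C = (k * g ^ n) • C := by
      rintro h ⟨n, hn⟩ h' hhh'
      have := hhh'.mono inter_subset_right
      rw [hn, ← smul_inv_smul (k * g ^ n) (h' • C), ← smul_set_inter, smul_set_nonempty,
        smul_smul] at this
      obtain ⟨m, hm⟩ := hoverlap _ this
      refine ⟨n + m, ?_⟩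
      rw [zpow_add, ← mul_assoc, mul_smul _ (g ^ m), ← hm, smul_smul, mul_inv_cancel_left]
    refine (subset_biUnion_of_isPreconnected_of_locallyFinite hlf (fun h ↦ hclosed.smul h)
      isPreconnected_connectedComponentIn (connectedComponentIn_subset _ _) overlap_mem
      ⟨k, ⟨0, by rw [zpow_zero, mul_one]⟩, x,
        mem_connectedComponentIn (mem_iUnion_of_mem k hx), hx⟩).trans ?_
    exact iUnion₂_subset fun h ⟨n, hn⟩ ↦
      hn.subset.trans (subset_iUnion (fun n : ℤ ↦ (k * g ^ n) • C) n)
  · refine IsPreconnected.subset_connectedComponentIn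
      (IsPreconnected.iUnion_of_chain (fun n ↦ isPreconnected_smul _) fun n ↦ ?_)
      (mem_iUnion_of_mem 0 (by rwa [zpow_zero, mul_one]))
      (iUnion_subset fun n ↦ subset_iUnion (fun h : G ↦ h • C) _)
    rw [Order.succ_eq_add_one, zpow_add_one, ← mul_assoc, mul_smul _ g, ← smul_set_inter]
    exact hne.smul_set

theorem exists_isCompact_forall_exists_smul_mem [WeaklyLocallyCompactSpace X]
    [CompactSpace (Quotient (MulAction.orbitRel G X))] :
    ∃ K : Set X, IsCompact K ∧ ∀ x, ∃ g : G, g • x ∈ K := by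
  choose N hN hN_nhds using fun x : X ↦ exists_compact_mem_nhds x
  let mk : X → Quotient (MulAction.orbitRel G X) := Quotient.mk _
  have image_mem_nhds (q : Quotient (MulAction.orbitRel G X)) : mk '' N q.out ∈ 𝓝 q := by
    simpa only [mk, Quotient.out_eq] using
      (MulAction.isOpenQuotientMap_quotientMk (Γ := G)).isOpenMap.image_mem_nhds (hN_nhds q.out)
  obtain ⟨t, -, ht⟩ := isCompact_univ.elim_nhds_subcover _ fun q _ ↦ image_mem_nhds q
  refine ⟨⋃ q ∈ t, N q.out, t.isCompact_biUnion fun q _ ↦ hN _, fun x ↦ ?_⟩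
  obtain ⟨q, hq, y, hy, hyx⟩ := mem_iUnion₂.1 (ht (mem_univ (mk x)))
  obtain ⟨g, rfl⟩ : ∃ g : G, g • x = y := Quotient.exact hyx
  exact ⟨g, mem_biUnion hq hy⟩

theorem isCoveringMap_quotientMk_orbitRel [T2Space X] [LocallyCompactSpace X]
    [ProperlyDiscontinuousSMul G X]
    (hfree : ∀ g : G, (∃ x : X, g • x = x) → ∀ x : X, g • x = x) :
    IsCoveringMap (Quotient.mk (MulAction.orbitRel G X)) := by
  -- The quotient of `G` by the kernel of the action acts freely, with the same orbits.
  let Q := (MulAction.toPermHom G X).range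
  have : ContinuousConstSMul Q X := ⟨by
    rintro ⟨_, g, rfl⟩
    exact continuous_const_smul g⟩
  have : ProperlyDiscontinuousSMul Q X := ⟨fun {K L} hK hL ↦ by
    refine ((ProperlyDiscontinuousSMul.finite_disjoint_inter_image (Γ := G) hK hL).image
      (MulAction.toPermHom G X).rangeRestrict).subset ?_
    rintro ⟨_, g, rfl⟩ hne
    exact ⟨g, hne, rfl⟩⟩
  have : IsCancelSMul Q X := isCancelSMul_iff_eq_one_of_smul_eq.2 <| by
    rintro ⟨_, g, rfl⟩ x hx
    exact Subtype.ext (Equiv.ext (hfree g ⟨x, hx⟩))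
  refine (isQuotientMap_quotient_mk'.isQuotientCoveringMap_of_properlyDiscontinuousSMul (G := Q)
    fun {x y} ↦ ?_).isCoveringMap
  refine Quotient.eq''.trans ⟨?_, ?_⟩
  · rintro ⟨g, hg⟩
    exact ⟨⟨_, g, rfl⟩, hg⟩
  · rintro ⟨⟨_, g, rfl⟩, hg⟩
    exact ⟨g, hg⟩

end GroupAction

section Displacement

variable {G X : Type*} [Group G] [MetricSpace X] [ProperSpace X] [MulAction G X]
  [IsIsometricSMul G X] [ProperlyDiscontinuousSMul G X]
  (hfree : ∀ g : G, (∃ x : X, g • x = x) → ∀ x : X, g • x = x)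
include hfree

theorem exists_forall_mem_le_dist_smul {K : Set X} (hK : IsCompact K) :
    ∃ δ > 0, ∀ g : G, (∃ x : X, g • x ≠ x) → ∀ x ∈ K, δ ≤ dist x (g • x) := by
  have finite : {g : G | (g • K ∩ cthickening 1 K).Nonempty}.Finite :=
    ProperlyDiscontinuousSMul.finite_disjoint_inter_image hK hK.cthickening
  have bound (g : G) : ∃ δ > 0, (∃ x : X, g • x ≠ x) → ∀ x ∈ K, δ ≤ dist x (g • x) := by
    by_cases hg : ∃ x : X, g • x ≠ x
    · obtain ⟨y, hy⟩ := hg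
      obtain ⟨δ, hδ, hle⟩ := hK.exists_forall_le' (f := fun x ↦ dist x (g • x)) (a := 0)
        (continuous_id.dist (continuous_const_smul g)).continuousOn
        fun x _ ↦ dist_pos.2 fun hx ↦ hy (hfree g ⟨x, hx.symm⟩ y)
      exact ⟨δ, hδ, fun _ ↦ hle⟩
    · exact ⟨1, one_pos, fun h ↦ absurd h hg⟩
  choose δ hδ hle using bound
  obtain ⟨δ₀, hδ₀, hδ₀_le⟩ : ∃ δ₀ > 0, ∀ g ∈ {g : G | (g • K ∩ cthickening 1 K).Nonempty},
      δ₀ ≤ δ g := by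
    have : ∀ᶠ r in 𝓝[>] (0 : ℝ), ∀ g ∈ {g : G | (g • K ∩ cthickening 1 K).Nonempty}, r ≤ δ g :=
      (eventually_all_finite finite).2 fun g _ ↦
        eventually_nhdsWithin_of_eventually_nhds (eventually_le_nhds (hδ g))
    exact ((eventually_mem_nhdsWithin (s := Ioi 0)).and this).exists
  refine ⟨min δ₀ 1, lt_min hδ₀ one_pos, fun g hg x hx ↦ ?_⟩
  by_cases hgx : dist x (g • x) ≤ 1
  · exact (min_le_left _ _).trans ((hδ₀_le g ⟨g • x, smul_mem_smul_set hx,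
      mem_cthickening_of_dist_le _ x _ _ hx (dist_comm x _ ▸ hgx)⟩).trans (hle g hg x hx))
  · exact (min_le_right _ _).trans (not_le.1 hgx).le

theorem exists_le_dist_smul [CompactSpace (Quotient (MulAction.orbitRel G X))] :
    ∃ δ > 0, ∀ g : G, (∃ x : X, g • x ≠ x) → ∀ x : X, δ ≤ dist x (g • x) := by
  obtain ⟨K, hK, hcover⟩ := exists_isCompact_forall_exists_smul_mem (G := G) (X := X)
  obtain ⟨δ, hδ, hle⟩ := exists_forall_mem_le_dist_smul hfree hK
  refine ⟨δ, hδ, fun g ⟨y, hy⟩ x ↦ ?_⟩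
  obtain ⟨h, hx⟩ := hcover x
  have conj_smul (z : X) : (h * g * h⁻¹) • h • z = h • g • z := by
    rw [smul_smul, inv_mul_cancel_right, mul_smul]
  have hconj : (h * g * h⁻¹) • h • y ≠ h • y := by
    rwa [conj_smul, Ne, smul_left_cancel_iff]
  simpa only [conj_smul, dist_smul] using hle (h * g * h⁻¹) ⟨h • y, hconj⟩ _ hx

end Displacement

section SurfaceGroup

variable {Γ : Subgroup SL(2, ℝ)}

instance : IsIsometricSMul Γ ℍ := ⟨fun γ ↦ isometry_smul ℍ (γ : SL(2, ℝ))⟩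

theorem HypSurface.proj_eq_proj_iff {z w : ℍ} :
    HypSurface.proj Γ z = HypSurface.proj Γ w ↔ ∃ γ : Γ, γ • w = z :=
  Quotient.eq''

theorem HypSurface.proj_smul (γ : Γ) (z : ℍ) : HypSurface.proj Γ (γ • z) = HypSurface.proj Γ z :=
  HypSurface.proj_eq_proj_iff.2 ⟨γ, rfl⟩

theorem HypSurface.preimage_range_eq_iUnion_smul {A : Type*} {f : A → HypSurface Γ} {F : A → ℍ}
    (hF : ∀ a, HypSurface.proj Γ (F a) = f a) :
    HypSurface.proj Γ ⁻¹' range f = ⋃ γ : Γ, γ • range F := by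
  ext z
  simp only [mem_preimage, mem_range, ← hF, HypSurface.proj_eq_proj_iff, eq_comm (b := proj Γ z),
    mem_iUnion, mem_smul_set, exists_exists_eq_and]
  exact exists_comm

namespace IsClosedSurfaceGroup

variable (hΓ : IsClosedSurfaceGroup Γ)
include hΓ

theorem exists_lift {E : Type*} [AddCommGroup E] [Module ℝ E] [TopologicalSpace E]
    [IsTopologicalAddGroup E] [ContinuousSMul ℝ E] [LocallyConvexSpace ℝ E] {A : Set E}
    (hA : Convex ℝ A) (hne : A.Nonempty) (f : C(A, HypSurface Γ)) :
    ∃ F : C(A, ℍ), ∀ a, HypSurface.proj Γ (F a) = f a := by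
  have := hΓ.properlyDiscontinuous
  have := hA.contractibleSpace hne
  have := hA.locallyPathConnectedSpace
  obtain ⟨a₀⟩ := hne.to_subtype
  obtain ⟨z₀, hz₀⟩ := Quotient.exists_rep (f a₀)
  obtain ⟨F, ⟨-, hF⟩, -⟩ :=
    (isCoveringMap_quotientMk_orbitRel hΓ.free).existsUnique_continuousMap_lifts f a₀ z₀ hz₀
  exact ⟨F, congrFun hF⟩

theorem exists_hasCoarseProjection_cyclicOrbit (g : Γ) {C : Set ℍ} (hne : C.Nonempty)
    (hC : Bornology.IsBounded C) : ∃ c, HasCoarseProjection (cyclicOrbit g C) c := by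
  have := hΓ.properlyDiscontinuous
  have := hΓ.cocompact
  by_cases hg : ∃ z : ℍ, g • z ≠ z
  · obtain ⟨δ, hδ, hdisp⟩ := exists_le_dist_smul hΓ.free
    exact _root_.exists_hasCoarseProjection_cyclicOrbit (g := (g : SL(2, ℝ))) hδ (hdisp g hg) hne hC
  · have smul_eq : g • C = C := by
      push Not at hg
      simp only [← image_smul, hg, image_id']
    rw [cyclicOrbit_eq_of_smul_eq smul_eq]
    exact HasCoarseProjection.exists_of_isBounded hne hC

end IsClosedSurfaceGroup

end SurfaceGroup

namespace OneVertexTriangulation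

variable {X : Type*} [TopologicalSpace X] (T : OneVertexTriangulation X)

theorem eq_or_endpoints_of_edge_eq {i : Fin T.numEdges} {s t : unitInterval}
    (h : T.edge i s = T.edge i t) : s = t ∨ (s = 0 ∨ s = 1) ∧ (t = 0 ∨ t = 1) := by
  have edge_eq_vertex {s : unitInterval} (hs : s = 0 ∨ s = 1) : T.edge i s = T.vertex := by
    rcases hs with rfl | rfl
    exacts [Path.source _, Path.target _]
  have endpoint_or_mem_Ioo (s : unitInterval) : (s = 0 ∨ s = 1) ∨ s ∈ Ioo 0 1 :=
    or_assoc.2 (eq_endpoints_or_mem_Ioo_of_mem_Icc ⟨bot_le, le_top⟩)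
  rcases endpoint_or_mem_Ioo s with hs | hs <;> rcases endpoint_or_mem_Ioo t with ht | ht
  · exact Or.inr ⟨hs, ht⟩
  · exact absurd (h.symm.trans (edge_eq_vertex hs)) (T.edge_ne_vertex i t ht)
  · exact absurd (h.trans (edge_eq_vertex ht)) (T.edge_ne_vertex i s hs)
  · exact Or.inl (T.edge_injective i i s hs t ht h).2

theorem pos_of_triangle_notMem_range_edge {k : Fin T.numTriangles} {p : stdSimplex ℝ (Fin 3)}
    (hp : ∀ i, T.triangle k p ∉ range (T.edge i)) (a : Fin 3) : 0 < (p : Fin 3 → ℝ) a := by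
  refine (p.2.1 a).lt_of_ne fun ha ↦ ?_
  obtain ⟨i, hi | hi⟩ := T.side k a <;>
    exact hp i (by rw [hi p ha.symm, ← Path.extend_range]; exact mem_range_self _)

theorem exists_mem_range_triangle_of_forall_notMem_range_edge [Nonempty (Fin T.numEdges)] {x : X}
    (hx : ∀ i, x ∉ range (T.edge i)) : ∃ k, x ∈ range (T.triangle k) := by
  obtain ⟨i⟩ := ‹Nonempty (Fin T.numEdges)›
  rcases T.cover x with rfl | ⟨j, hj⟩ | h
  · exact absurd ⟨0, Path.source _⟩ (hx i)
  · exact absurd hj (hx j)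
  · exact h

end OneVertexTriangulation

section Walls

variable {Γ : Subgroup SL(2, ℝ)} (hΓ : IsClosedSurfaceGroup Γ)
  (T : OneVertexTriangulation (HypSurface Γ))
include hΓ

variable {T} in
theorem exists_smul_range_eq_zpow_smul_range {i : Fin T.numEdges} {e : unitInterval → ℍ}
    (he : ∀ s, HypSurface.proj Γ (e s) = T.edge i s) {g : Γ} (hg : g • e 0 = e 1) {γ : Γ}
    (hγ : (range e ∩ γ • range e).Nonempty) : ∃ n : ℤ, γ • range e = g ^ n • range e := by
  obtain ⟨_, ⟨s, rfl⟩, _, ⟨t, rfl⟩, hst⟩ := hγ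
  replace hst : γ • e t = e s := hst
  have exists_zpow {r : unitInterval} (hr : r = 0 ∨ r = 1) : ∃ n : ℤ, e r = g ^ n • e 0 := by
    rcases hr with rfl | rfl
    exacts [⟨0, by rw [zpow_zero, one_smul]⟩, ⟨1, by rw [zpow_one, hg]⟩]
  have edge_eq : T.edge i s = T.edge i t := by rw [← he, ← he, ← hst, HypSurface.proj_smul]
  rcases T.eq_or_endpoints_of_edge_eq edge_eq with rfl | ⟨hs, ht⟩
  · exact ⟨0, smul_set_eq_smul_set_of_smul_eq_smul hΓ.free
      (by rw [hst, zpow_zero, one_smul]) _⟩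
  · obtain ⟨m, hm⟩ := exists_zpow hs
    obtain ⟨n, hn⟩ := exists_zpow ht
    refine ⟨m - n, smul_set_eq_smul_set_of_smul_eq_smul hΓ.free (x := e t) ?_ _⟩
    rw [hst, hm, hn, smul_smul, ← zpow_add, sub_add_cancel]

theorem exists_connectedComponentIn_eq_smul_cyclicOrbit (i : Fin T.numEdges) :
    ∃ (C : Set ℍ) (g : Γ), IsCompact C ∧
      ∀ z ∈ HypSurface.proj Γ ⁻¹' range (T.edge i), ∃ γ : Γ, z ∈ γ • C ∧
        connectedComponentIn (HypSurface.proj Γ ⁻¹' range (T.edge i)) z = γ • cyclicOrbit g C := by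
  have := hΓ.properlyDiscontinuous
  obtain ⟨e, he⟩ :=
    hΓ.exists_lift (convex_Icc 0 1) ⟨0, unitInterval.zero_mem⟩ (T.edge i).toContinuousMap
  obtain ⟨g, hg⟩ : ∃ g : Γ, g • e 0 = e 1 := by
    rw [← HypSurface.proj_eq_proj_iff, he, he]
    exact (T.edge i).target.trans (T.edge i).source.symm
  have isCompact_range_e : IsCompact (range e) := isCompact_range e.continuous
  have locallyFinite : LocallyFinite fun γ : Γ ↦ γ • range e :=
    (locallyFinite_smul_set (ι := Unit) fun _ ↦ isCompact_range_e).comp_injective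
      (Prod.mk_right_injective ())
  refine ⟨range e, g, isCompact_range_e, fun z hz ↦ ?_⟩
  rw [HypSurface.preimage_range_eq_iUnion_smul (f := T.edge i) he] at hz ⊢
  obtain ⟨γ, hγ⟩ := mem_iUnion.1 hz
  exact ⟨γ, hγ, connectedComponentIn_iUnion_smul isCompact_range_e.isClosed
    (isPreconnected_range e.continuous) ⟨e 1, mem_range_self 1, e 0, mem_range_self 0, hg⟩
    locallyFinite (fun _ ↦ exists_smul_range_eq_zpow_smul_range hΓ he hg) hγ⟩

theorem exists_walls_eq_smul_cyclicOrbit :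
    ∃ (C : Fin T.numEdges → Set ℍ) (g : Fin T.numEdges → Γ), (∀ i, IsCompact (C i)) ∧
      ∀ w ∈ walls T, ∀ z ∈ w, ∃ i, ∃ γ : Γ, z ∈ γ • C i ∧ w = γ • cyclicOrbit (g i) (C i) := by
  choose C g hC hcomp using exists_connectedComponentIn_eq_smul_cyclicOrbit hΓ T
  refine ⟨C, g, hC, ?_⟩
  rintro _ ⟨i, y, -, rfl⟩ z hz
  obtain ⟨γ, hγ, hzγ⟩ := hcomp i z (connectedComponentIn_subset _ _ hz)
  exact ⟨i, γ, hγ, (connectedComponentIn_eq hz).trans hzγ⟩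

theorem finite_walls_inter_nonempty {K : Set ℍ} (hK : IsCompact K) :
    {w ∈ walls T | (w ∩ K).Nonempty}.Finite := by
  have := hΓ.properlyDiscontinuous
  obtain ⟨C, g, hC, hwalls⟩ := exists_walls_eq_smul_cyclicOrbit hΓ T
  have finite (i : Fin T.numEdges) : {γ : Γ | (γ • C i ∩ K).Nonempty}.Finite :=
    ProperlyDiscontinuousSMul.finite_disjoint_inter_image (hC i) hK
  refine (finite_iUnion fun i ↦ (finite i).image fun γ ↦ γ • cyclicOrbit (g i) (C i)).subset ?_
  rintro w ⟨hw, z, hzw, hzK⟩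
  obtain ⟨i, γ, hzγ, rfl⟩ := hwalls w hw z hzw
  exact mem_iUnion.2 ⟨i, γ, ⟨z, hzγ, hzK⟩, rfl⟩

theorem exists_hasCoarseProjection_walls : ∃ c, ∀ w ∈ walls T, HasCoarseProjection w c := by
  obtain ⟨C, g, hC, hwalls⟩ := exists_walls_eq_smul_cyclicOrbit hΓ T
  have hasCoarseProjection (i : Fin T.numEdges) :
      ∃ c, (C i).Nonempty → HasCoarseProjection (cyclicOrbit (g i) (C i)) c := by
    by_cases hne : (C i).Nonempty
    · obtain ⟨c, hc⟩ := hΓ.exists_hasCoarseProjection_cyclicOrbit (g i) hne (hC i).isBounded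
      exact ⟨c, fun _ ↦ hc⟩
    · exact ⟨0, fun h ↦ absurd h hne⟩
  choose c hc using hasCoarseProjection
  obtain ⟨c', hc'⟩ := (finite_range c).bddAbove
  refine ⟨c', fun w hw ↦ ?_⟩
  obtain ⟨i, z, hz, rfl⟩ := id hw
  obtain ⟨j, γ, hzγ, h⟩ := hwalls _ hw z (mem_connectedComponentIn hz)
  rw [h]
  exact ((hc j (smul_set_nonempty.1 ⟨z, hzγ⟩)).image (IsometryEquiv.constSMul γ)).mono
    (hc' (mem_range_self j))

variable {T} in
theorem smul_range_eq_smul_range_of_forall_notMem_range_edge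
    {f : Fin T.numTriangles → stdSimplex ℝ (Fin 3) → ℍ}
    (hf : ∀ k p, HypSurface.proj Γ (f k p) = T.triangle k p) {z : ℍ}
    (hz : ∀ i, HypSurface.proj Γ z ∉ range (T.edge i)) {k k' : Fin T.numTriangles} {γ γ' : Γ}
    (h : z ∈ γ • range (f k)) (h' : z ∈ γ' • range (f k')) :
    γ • range (f k) = γ' • range (f k') := by
  obtain ⟨_, ⟨p, rfl⟩, rfl⟩ := h
  obtain ⟨_, ⟨p', rfl⟩, hp'⟩ := h'
  replace hp' : γ' • f k' p' = γ • f k p := hp'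
  replace hz : ∀ i, T.triangle k p ∉ range (T.edge i) := fun i ↦ by
    rw [← hf, ← HypSurface.proj_smul γ]
    exact hz i
  have triangle_eq : T.triangle k p = T.triangle k' p' := by
    rw [← hf, ← hf, ← HypSurface.proj_smul γ, ← hp', HypSurface.proj_smul]
  obtain ⟨rfl, rfl⟩ := T.triangle_injective k k' p p' (T.pos_of_triangle_notMem_range_edge hz)
    (T.pos_of_triangle_notMem_range_edge (triangle_eq ▸ hz)) triangle_eq
  exact smul_set_eq_smul_set_of_smul_eq_smul hΓ.free hp'.symm _

variable {T} in
theorem exists_subset_smul_range_of_disjoint_walls [Nonempty (Fin T.numEdges)]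
    {f : Fin T.numTriangles → C(stdSimplex ℝ (Fin 3), ℍ)}
    (hf : ∀ k p, HypSurface.proj Γ (f k p) = T.triangle k p) {S : Set ℍ} (hS : IsPreconnected S)
    (hne : S.Nonempty) (hdisj : ∀ w ∈ walls T, Disjoint S w) :
    ∃ k, ∃ γ : Γ, S ⊆ γ • range (f k) := by
  have := hΓ.properlyDiscontinuous
  have notMem_edge : ∀ z ∈ S, ∀ i, HypSurface.proj Γ z ∉ range (T.edge i) := fun z hz i hzi ↦
    disjoint_left.1 (hdisj _ ⟨i, z, hzi, rfl⟩) hz (mem_connectedComponentIn hzi)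
  have isCompact_range_f (k) : IsCompact (range (f k)) := isCompact_range (f k).continuous
  have cover : S ⊆ ⋃ q : Fin T.numTriangles × Γ, q.2 • range (f q.1) := fun z hz ↦ by
    obtain ⟨k, hk⟩ := T.exists_mem_range_triangle_of_forall_notMem_range_edge (notMem_edge z hz)
    have : z ∈ HypSurface.proj Γ ⁻¹' range (T.triangle k) := hk
    rw [HypSurface.preimage_range_eq_iUnion_smul (hf k)] at this
    obtain ⟨γ, hγ⟩ := mem_iUnion.1 this
    exact mem_iUnion.2 ⟨(k, γ), hγ⟩
  obtain ⟨z, hz⟩ := hne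
  obtain ⟨q, hzq⟩ := mem_iUnion.1 (cover hz)
  exact ⟨q.1, q.2, subset_of_isPreconnected_of_locallyFinite
    (f := fun q : Fin T.numTriangles × Γ ↦ q.2 • range (f q.1))
    (locallyFinite_smul_set isCompact_range_f) (fun q ↦ (isCompact_range_f q.1).isClosed.smul q.2)
    hS cover (fun q q' ⟨x, hx, hxq, hxq'⟩ ↦ smul_range_eq_smul_range_of_forall_notMem_range_edge
      hΓ hf (notMem_edge x hx) hxq hxq') ⟨z, hz, hzq⟩⟩

theorem exists_dist_le_of_disjoint_walls [Nonempty (Fin T.numEdges)] :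
    ∃ R ≥ 0, ∀ S : Set ℍ, IsPreconnected S → (∀ w ∈ walls T, Disjoint S w) →
      ∀ x ∈ S, ∀ y ∈ S, dist x y ≤ R := by
  choose f hf using fun k ↦ hΓ.exists_lift (convex_stdSimplex ℝ (Fin 3))
    ⟨_, single_mem_stdSimplex ℝ 0⟩ (T.triangle k)
  obtain ⟨R, hR⟩ := isBounded_iff.1
    (isCompact_iUnion fun k ↦ isCompact_range (f k).continuous).isBounded
  refine ⟨max R 0, le_max_right _ _, fun S hS hdisj x hx y hy ↦ ?_⟩
  obtain ⟨k, γ, hsub⟩ := exists_subset_smul_range_of_disjoint_walls hΓ hf hS ⟨x, hx⟩ hdisj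
  obtain ⟨x', hx', rfl⟩ := hsub hx
  obtain ⟨y', hy', rfl⟩ := hsub hy
  exact (dist_smul γ x' y').trans_le
    ((hR (mem_iUnion_of_mem k hx') (mem_iUnion_of_mem k hy')).trans (le_max_left _ _))

end Walls

section Paths

variable {α X : Type*} [PseudoMetricSpace X] {L : α → X} {R : ℝ}

theorem dist_le_card_add_one_mul [LinearOrder α] (B : Finset α) {a b : α} (hab : a ≤ b)
    (h : ∀ c ∈ Icc a b, ∀ d ∈ Icc a b, c ≤ d → Disjoint (B : Set α) (Ioo c d) →
      dist (L c) (L d) ≤ R) :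
    dist (L a) (L b) ≤ (B.card + 1) * R := by
  induction B using Finset.induction_on_max generalizing b with
  | empty => simpa using h a (left_mem_Icc.2 hab) b (right_mem_Icc.2 hab) hab (by simp)
  | insert m B hm ih =>
    have hR : 0 ≤ R := dist_nonneg.trans
      (h a (left_mem_Icc.2 hab) a (left_mem_Icc.2 hab) le_rfl (by simp))
    rw [Finset.card_insert_of_notMem fun hmB ↦ (hm m hmB).false, Nat.cast_succ]
    simp only [Finset.coe_insert, disjoint_insert_left] at h
    by_cases hmab : m ∈ Ioo a b
    · have before : dist (L a) (L m) ≤ (B.card + 1) * R := ih hmab.1.le fun c hc d hd hcd hB ↦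
        h c (Icc_subset_Icc_right hmab.2.le hc) d (Icc_subset_Icc_right hmab.2.le hd) hcd
          ⟨fun hmcd ↦ hmcd.2.not_ge hd.2, hB⟩
      have after : dist (L m) (L b) ≤ R := h m (Ioo_subset_Icc_self hmab) b
        (right_mem_Icc.2 hab) hmab.2.le
        ⟨fun hmm ↦ hmm.1.false, disjoint_left.2 fun x hx hxm ↦ (hm x hx).not_gt hxm.1⟩
      linarith [dist_triangle (L a) (L m) (L b)]
    · have outside : dist (L a) (L b) ≤ (B.card + 1) * R := ih hab fun c hc d hd hcd hB ↦
        h c hc d hd hcd ⟨fun hmcd ↦ hmab ⟨hc.1.trans_lt hmcd.1, hmcd.2.trans_le hd.2⟩, hB⟩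
      linarith

theorem dist_le_of_forall_Ioo_dist_le [LinearOrder α] [DenselyOrdered α] [TopologicalSpace α]
    [OrderTopology α] (hL : Continuous L) (hR : 0 ≤ R) {a b : α} (hab : a ≤ b)
    (h : ∀ s ∈ Ioo a b, ∀ t ∈ Ioo a b, dist (L s) (L t) ≤ R) : dist (L a) (L b) ≤ R := by
  rcases hab.eq_or_lt with rfl | hab
  · simpa using hR
  have isClosed_le_R : IsClosed {p : α × α | dist (L p.1) (L p.2) ≤ R} :=
    isClosed_le ((hL.comp continuous_fst).dist (hL.comp continuous_snd)) continuous_const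
  have endpoints_mem : (a, b) ∈ closure (Ioo a b ×ˢ Ioo a b) := by
    rw [closure_prod_eq, closure_Ioo hab.ne]
    exact ⟨left_mem_Icc.2 hab.le, right_mem_Icc.2 hab.le⟩
  exact closure_minimal (fun p hp ↦ h p.1 hp.1 p.2 hp.2) isClosed_le_R endpoints_mem

variable [ConditionallyCompleteLinearOrder α] [DenselyOrdered α] [TopologicalSpace α]
  [OrderTopology α] {𝒲 : Set (Set X)}

theorem dist_le_of_forall_mem_finset (hL : Continuous L) (hR : 0 ≤ R)
    (hdist : ∀ S, IsPreconnected S → (∀ w ∈ 𝒲, Disjoint S w) → ∀ x ∈ S, ∀ y ∈ S, dist x y ≤ R)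
    (honce : ∀ w ∈ 𝒲, (L ⁻¹' w).Subsingleton) (F : Finset (Set X)) {s t : α} (hst : s ≤ t)
    (hF : ∀ v ∈ Ioo s t, ∀ w ∈ 𝒲, L v ∈ w → w ∈ F) :
    dist (L s) (L t) ≤ (F.card + 1) * R := by
  have finite_times : {v | ∃ w ∈ F, w ∈ 𝒲 ∧ L v ∈ w}.Finite := by
    refine ((F.finite_toSet.inter_of_left 𝒲).biUnion fun w hw ↦ (honce w hw.2).finite).subset ?_
    rintro v ⟨w, hwF, hw, hv⟩
    exact mem_biUnion (show w ∈ ↑F ∩ 𝒲 from ⟨hwF, hw⟩) hv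
  let B := finite_times.toFinset
  have card_le : B.card ≤ F.card :=
    Finset.card_le_card_of_forall_subsingleton (fun v w ↦ w ∈ 𝒲 ∧ L v ∈ w)
      (fun v hv ↦ finite_times.mem_toFinset.1 hv)
      fun w _ v hv v' hv' ↦ honce w hv.2.1 hv.2.2 hv'.2.2
  calc dist (L s) (L t)
      ≤ (B.card + 1) * R := dist_le_card_add_one_mul B hst fun c hc d hd hcd hB ↦ by
        refine dist_le_of_forall_Ioo_dist_le hL hR hcd fun x hx y hy ↦
          hdist (L '' Ioo c d) (isPreconnected_Ioo.image L hL.continuousOn) (fun w hw ↦ ?_)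
            _ (mem_image_of_mem L hx) _ (mem_image_of_mem L hy)
        rw [disjoint_left, forall_mem_image]
        intro v hv hvw
        have hvF : w ∈ F := hF v ⟨hc.1.trans_lt hv.1, hv.2.trans_le hd.2⟩ w hw hvw
        exact disjoint_left.1 hB (finite_times.mem_toFinset.2 ⟨w, hvF, hw, hvw⟩) hv
    _ ≤ (F.card + 1) * R := by gcongr

theorem exists_notMem_finset_dist_le [OrderBot α] (hL : Continuous L) (hR : 0 ≤ R)
    (hdist : ∀ S, IsPreconnected S → (∀ w ∈ 𝒲, Disjoint S w) → ∀ x ∈ S, ∀ y ∈ S, dist x y ≤ R)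
    (honce : ∀ w ∈ 𝒲, (L ⁻¹' w).Subsingleton)
    (hfin : ∀ K, IsCompact K → {w ∈ 𝒲 | (w ∩ K).Nonempty}.Finite)
    (hinf : {w ∈ 𝒲 | ∃ t, L t ∈ w}.Infinite) (F : Finset (Set X)) (s : α) :
    ∃ w ∈ 𝒲, w ∉ F ∧ ∃ t ≥ s, L t ∈ w ∧ dist (L s) (L t) ≤ (F.card + 1) * R := by
  have finite_hit (a b : α) : {w ∈ 𝒲 | (w ∩ L '' Icc a b).Nonempty}.Finite :=
    hfin _ (isCompact_Icc.image hL)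
  obtain ⟨w₁, ⟨hw₁, t₁, ht₁⟩, hnew⟩ :=
    hinf.exists_notMem_finite ((finite_hit ⊥ s).union F.finite_toSet)
  rw [mem_union, not_or] at hnew
  have hst₁ : s ≤ t₁ := by
    by_contra! hlt
    exact hnew.1 ⟨hw₁, L t₁, ht₁, t₁, ⟨bot_le, hlt.le⟩, rfl⟩
  let A := {t ∈ Icc s t₁ | ∃ w ∈ 𝒲, w ∉ F ∧ L t ∈ w}
  have finite_A : A.Finite := by
    refine ((finite_hit s t₁).biUnion fun w hw ↦ (honce w hw.1).finite).subset ?_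
    rintro t ⟨ht, w, hw, -, htw⟩
    exact mem_biUnion (show w ∈ {w ∈ 𝒲 | _} from ⟨hw, L t, htw, t, ht, rfl⟩) htw
  obtain ⟨t, ⟨⟨hst, htt₁⟩, w, hw, hwF, htw⟩, hmin⟩ :=
    finite_A.isCompact.exists_isLeast ⟨t₁, ⟨hst₁, le_rfl⟩, w₁, hw₁, hnew.2, ht₁⟩
  refine ⟨w, hw, hwF, t, hst, htw, dist_le_of_forall_mem_finset hL hR hdist honce F hst ?_⟩
  intro v hv w' hw' hvw'
  by_contra hF
  exact hv.2.not_ge (hmin ⟨⟨hv.1.le, hv.2.le.trans htt₁⟩, w', hw', hF, hvw'⟩)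

end Paths

section Rays

theorem CrossesAt.notMem_of_isPreconnected {L : ℝ≥0 → ℍ} {w : Set ℍ} {t : ℝ≥0}
    (hcross : CrossesAt L w t) (hL : Continuous L) (honce : ∀ s, L s ∈ w → s = t) {P : Set ℍ}
    (hP : IsPreconnected P) (hPw : P ⊆ wᶜ) {s u : ℝ≥0} (hst : s < t) (htu : t < u)
    (hs : L s ∈ P) : L u ∉ P := fun hu ↦ by
  have component_eq {A : Set ℍ} (hA : IsPreconnected A) (hAw : A ⊆ wᶜ) {x y : ℍ} (hx : x ∈ A)
      (hy : y ∈ A) : connectedComponentIn wᶜ x = connectedComponentIn wᶜ y :=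
    connectedComponentIn_eq (hA.subset_connectedComponentIn hx hAw hy)
  have component_path_eq {I : Set ℝ≥0} (hI : IsPreconnected I) (ht : t ∉ I) {v v' : ℝ≥0}
      (hv : v ∈ I) (hv' : v' ∈ I) :
      connectedComponentIn wᶜ (L v) = connectedComponentIn wᶜ (L v') :=
    component_eq (hI.image L hL.continuousOn)
      (forall_mem_image.2 fun x hx hxw ↦ ht (honce x hxw ▸ hx))
      (mem_image_of_mem L hv) (mem_image_of_mem L hv')
  have := nhdsLT_neBot_of_exists_lt ⟨s, hst⟩
  have := nhdsGT_neBot_of_exists_gt ⟨u, htu⟩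
  obtain ⟨s', hs', hs'_mem⟩ := (hcross.and (Ico_mem_nhdsLT hst)).exists
  obtain ⟨u', ⟨-, -, hne⟩, hu'_mem⟩ := (hs'.and (Ioc_mem_nhdsGT htu)).exists
  refine hne ?_
  calc connectedComponentIn wᶜ (L s')
      = connectedComponentIn wᶜ (L s) :=
        component_path_eq isPreconnected_Ico right_notMem_Ico hs'_mem (left_mem_Ico.2 hst)
    _ = connectedComponentIn wᶜ (L u) := component_eq hP hPw hs hu
    _ = connectedComponentIn wᶜ (L u') :=
        component_path_eq isPreconnected_Ioc left_notMem_Ioc (right_mem_Ioc.2 htu) hu'_mem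

theorem exists_norm_toDisc_le_of_isBounded {D : Set ℍ} (hD : Bornology.IsBounded D) :
    ∃ ρ < 1, ∀ z ∈ D, ‖toDisc z‖ ≤ ρ := by
  rcases (closure D).eq_empty_or_nonempty with hempty | hne
  · exact ⟨0, one_pos, fun z hz ↦ absurd (subset_closure hz) (hempty ▸ notMem_empty z)⟩
  · obtain ⟨z₀, -, hz₀⟩ :=
      hD.isCompact_closure.exists_isMaxOn hne continuous_toDisc.norm.continuousOn
    exact ⟨_, norm_toDisc_lt_one z₀, fun z hz ↦ hz₀ (subset_closure hz)⟩

theorem exists_hasEndpoint_of_eventually_mem_discCap {L : ℝ≥0 → ℍ}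
    (h : ∀ η > 0, ∃ u : ℂ, ‖u‖ = 1 ∧ ∀ᶠ t in atTop, L t ∈ discCap u (1 - η)) :
    ∃ ξ : Circle, HasEndpoint L ξ := by
  have cauchySeq_toDisc : CauchySeq fun t ↦ toDisc (L t) := by
    refine Metric.cauchySeq_iff'.2 fun ε hε ↦ ?_
    obtain ⟨u, hu, hev⟩ := h (ε ^ 2 / 32) (by positivity)
    obtain ⟨t₀, ht₀⟩ := eventually_atTop.1 hev
    have dist_le (t) (ht : t ≥ t₀) : dist (toDisc (L t)) u ≤ ε / 4 := by
      rw [dist_eq_norm]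
      refine le_of_sq_le_sq ?_ (by positivity)
      linarith [norm_toDisc_sub_sq_le hu (ht₀ t ht)]
    refine ⟨t₀, fun t ht ↦ ?_⟩
    linarith [dist_triangle_right (toDisc (L t)) (toDisc (L t₀)) u, dist_le t ht,
      dist_le t₀ le_rfl]
  obtain ⟨ζ, hζ⟩ := cauchySeq_tendsto_of_complete cauchySeq_toDisc
  have tendsto_norm : Tendsto (fun t ↦ ‖toDisc (L t)‖) atTop (𝓝 1) := by
    refine tendsto_order.2 ⟨fun a ha ↦ ?_, fun a ha ↦
      Eventually.of_forall fun t ↦ (norm_toDisc_lt_one _).trans ha⟩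
    obtain ⟨u, hu, hev⟩ := h ((1 - a) / 2) (by linarith)
    filter_upwards [hev] with t ht
    linarith [le_norm_toDisc_of_mem_discCap hu ht]
  exact ⟨⟨ζ, mem_sphere_zero_iff_norm.2 (tendsto_nhds_unique hζ.norm tendsto_norm)⟩, hζ⟩

theorem HasEndpoint.norm_sub_sq_le {L : ℝ≥0 → ℍ} {ξ : Circle} (h : HasEndpoint L ξ) {u : ℂ}
    (hu : ‖u‖ = 1) {η : ℝ} (hev : ∀ᶠ t in atTop, L t ∈ discCap u (1 - η)) :
    ‖(ξ : ℂ) - u‖ ^ 2 ≤ 2 * η :=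
  le_of_tendsto (((h.sub_const u).norm).pow 2) (hev.mono fun _ ↦ norm_toDisc_sub_sq_le hu)

theorem exists_angularDist_le_of_norm_sub_lt {ε : ℝ} (hε : 0 < ε) :
    ∃ δ > 0, ∀ ξ η : Circle, ‖(ξ : ℂ) - η‖ < δ → angularDist ξ η ≤ ε := by
  obtain ⟨δ, hδ, h⟩ :=
    Metric.continuousAt_iff.1 (Complex.continuousAt_arg Complex.one_mem_slitPlane) ε hε
  refine ⟨δ, hδ, fun ξ η hξη ↦ ?_⟩
  have dist_div_one : dist ((ξ : ℂ) / η) 1 < δ := by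
    rwa [dist_eq_norm, div_sub_one η.coe_ne_zero, norm_div, Circle.norm_coe, div_one]
  simpa [angularDist] using (h dist_div_one).le

theorem exists_angularDist_le_of_eventually_mem_discCap {ε : ℝ} (hε : 0 < ε) :
    ∃ η > 0, ∀ (u : ℂ) (L₁ L₂ : ℝ≥0 → ℍ) (ξ₁ ξ₂ : Circle), ‖u‖ = 1 →
      HasEndpoint L₁ ξ₁ → HasEndpoint L₂ ξ₂ →
      (∀ᶠ t in atTop, L₁ t ∈ discCap u (1 - η)) → (∀ᶠ t in atTop, L₂ t ∈ discCap u (1 - η)) →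
      angularDist ξ₁ ξ₂ ≤ ε := by
  obtain ⟨δ, hδ, hang⟩ := exists_angularDist_le_of_norm_sub_lt hε
  refine ⟨δ ^ 2 / 32, by positivity, fun u L₁ L₂ ξ₁ ξ₂ hu h₁ h₂ hcap₁ hcap₂ ↦ hang _ _ ?_⟩
  have near {L : ℝ≥0 → ℍ} {ξ : Circle} (h : HasEndpoint L ξ)
      (hcap : ∀ᶠ t in atTop, L t ∈ discCap u (1 - δ ^ 2 / 32)) : dist (ξ : ℂ) u ≤ δ / 4 := by
    rw [dist_eq_norm]
    refine le_of_sq_le_sq ?_ (by positivity)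
    linarith [h.norm_sub_sq_le hu hcap]
  rw [← dist_eq_norm]
  linarith [dist_triangle_right (ξ₁ : ℂ) ξ₂ u, near h₁ hcap₁, near h₂ hcap₂]

variable {Γ : Subgroup SL(2, ℝ)}

theorem exists_finset_forall_wall_subset_discCap (hΓ : IsClosedSurfaceGroup Γ)
    (T : OneVertexTriangulation (HypSurface Γ)) {η : ℝ} (hη : 0 < η) :
    ∃ F : Finset (Set ℍ), ∀ w ∈ walls T, w ∉ F → ∃ u : ℂ, ‖u‖ = 1 ∧ w ⊆ discCap u (1 - η) := by
  obtain ⟨c, hc⟩ := exists_hasCoarseProjection_walls hΓ T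
  obtain ⟨N, hN⟩ := exists_subset_discCap c hη
  refine ⟨(finite_walls_inter_nonempty hΓ T
    (isCompact_closedBall UpperHalfPlane.I N)).toFinset, fun w hw hwF ↦ hN w (hc w hw) ?_⟩
  by_contra hmeet
  exact hwF ((Set.Finite.mem_toFinset _).2 ⟨hw, not_disjoint_iff_nonempty_inter.1 hmeet⟩)

namespace IsWallTransverseRay

variable {T : OneVertexTriangulation (HypSurface Γ)}

theorem eventually_mem_discCap {L : ℝ≥0 → ℍ} (h : IsWallTransverseRay T L) {w : Set ℍ}
    (hw : w ∈ walls T) {u : ℂ} {c : ℝ} (hu : ‖u‖ = 1) (hwu : w ⊆ discCap u c) {s t : ℝ≥0}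
    (hst : s ≤ t) (ht : L t ∈ w) (hs : ‖toDisc (L s)‖ < c) :
    ∀ᶠ v in atTop, L v ∈ discCap u c := by
  have start_mem_compl : L s ∈ (discCap u c)ᶜ :=
    fun hcap ↦ (hs.trans_le (le_norm_toDisc_of_mem_discCap hu hcap)).false
  have hst' : s < t := hst.lt_of_ne fun heq ↦ start_mem_compl (hwu (heq ▸ ht))
  filter_upwards [eventually_gt_atTop t] with v hv
  exact not_notMem.1 <| (h.transverse w hw t ht).notMem_of_isPreconnected h.embedded.continuous
    (fun r hr ↦ h.once w hw r t hr ht) (isPreconnected_compl_discCap u c)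
    (compl_subset_compl.2 hwu) hst' hv start_mem_compl

theorem exists_wall_notMem_dist_le (hΓ : IsClosedSurfaceGroup Γ)
    (T : OneVertexTriangulation (HypSurface Γ)) :
    ∃ R, ∀ L, IsWallTransverseRay T L → ∀ (F : Finset (Set ℍ)) (s : ℝ≥0),
      ∃ w ∈ walls T, w ∉ F ∧ ∃ t ≥ s, L t ∈ w ∧ dist (L s) (L t) ≤ (F.card + 1) * R := by
  rcases isEmpty_or_nonempty (Fin T.numEdges) with hT | hT
  · refine ⟨0, fun L h ↦ ?_⟩
    obtain ⟨_, ⟨i, -⟩, -⟩ := h.infinite.nonempty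
    exact hT.elim i
  obtain ⟨R, hR, hdist⟩ := exists_dist_le_of_disjoint_walls hΓ T
  exact ⟨R, fun L h ↦ exists_notMem_finset_dist_le h.embedded.continuous hR hdist
    (fun w hw s hs t ht ↦ h.once w hw s t hs ht) (fun _ ↦ finite_walls_inter_nonempty hΓ T)
    h.infinite⟩

theorem exists_hasEndpoint (hΓ : IsClosedSurfaceGroup Γ) {L : ℝ≥0 → ℍ}
    (h : IsWallTransverseRay T L) : ∃ ξ : Circle, HasEndpoint L ξ := by
  refine exists_hasEndpoint_of_eventually_mem_discCap fun η hη ↦ ?_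
  set c := max (1 - η) ((1 + ‖toDisc (L 0)‖) / 2)
  have start_lt : ‖toDisc (L 0)‖ < c :=
    lt_max_of_lt_right (by linarith [norm_toDisc_lt_one (L 0)])
  have hc : c < 1 := max_lt (by linarith) (by linarith [norm_toDisc_lt_one (L 0)])
  obtain ⟨F, hF⟩ := exists_finset_forall_wall_subset_discCap hΓ T (sub_pos.2 hc)
  obtain ⟨_, hR⟩ := exists_wall_notMem_dist_le hΓ T
  obtain ⟨w, hw, hwF, t, hst, ht, -⟩ := hR L h F 0
  obtain ⟨u, hu, hwu⟩ := hF w hw hwF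
  rw [sub_sub_cancel] at hwu
  exact ⟨u, hu, (h.eventually_mem_discCap hw hu hwu hst ht start_lt).mono
    fun _ hv ↦ discCap_subset_discCap u (le_max_left _ _) hv⟩

end IsWallTransverseRay

end Rays

theorem mainTheorem4_general {Γ : Subgroup SL(2, ℝ)} (hΓ : IsClosedSurfaceGroup Γ)
    (T : OneVertexTriangulation (HypSurface Γ)) {D : Set ℍ} (hD : Bornology.IsBounded D) {ε : ℝ}
    (hε : 0 < ε) :
    ∃ K : Set ℍ, IsCompact K ∧
      ∀ L₁ L₂ : ℝ≥0 → ℍ, IsWallTransverseRay T L₁ → IsWallTransverseRay T L₂ →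
        ∀ s₁ s₂ : ℝ≥0, L₁ s₁ ∈ D → L₂ s₂ ∈ D →
          (∀ w ∈ walls T, (w ∩ K).Nonempty →
            (∃ t, s₁ ≤ t ∧ L₁ t ∈ w) → ∃ t, s₂ ≤ t ∧ L₂ t ∈ w) →
          ∃ ξ₁ ξ₂ : Circle, HasEndpoint L₁ ξ₁ ∧ HasEndpoint L₂ ξ₂ ∧ angularDist ξ₁ ξ₂ ≤ ε := by
  obtain ⟨η, hη, hangle⟩ := exists_angularDist_le_of_eventually_mem_discCap hε
  obtain ⟨ρ, hρ, hDρ⟩ := exists_norm_toDisc_le_of_isBounded hD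
  obtain ⟨r, hDr⟩ := hD.subset_closedBall UpperHalfPlane.I
  obtain ⟨R, hR⟩ := IsWallTransverseRay.exists_wall_notMem_dist_le hΓ T
  have hη' : 0 < min η ((1 - ρ) / 2) := lt_min hη (by linarith)
  obtain ⟨F, hF⟩ := exists_finset_forall_wall_subset_discCap hΓ T hη'
  refine ⟨closedBall UpperHalfPlane.I (r + (F.card + 1) * R), isCompact_closedBall _ _,
    fun L₁ L₂ h₁ h₂ s₁ s₂ hs₁ hs₂ hwalls ↦ ?_⟩
  obtain ⟨ξ₁, hξ₁⟩ := h₁.exists_hasEndpoint hΓ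
  obtain ⟨ξ₂, hξ₂⟩ := h₂.exists_hasEndpoint hΓ
  obtain ⟨w, hw, hwF, t₁, hst₁, ht₁, hdist⟩ := hR L₁ h₁ F s₁
  obtain ⟨t₂, hst₂, ht₂⟩ := hwalls w hw ⟨L₁ t₁, ht₁, mem_closedBall.2 <| by
    linarith [dist_triangle_left (L₁ t₁) UpperHalfPlane.I (L₁ s₁), mem_closedBall.1 (hDr hs₁)]⟩
    ⟨t₁, hst₁, ht₁⟩
  obtain ⟨u, hu, hwu⟩ := hF w hw hwF
  have hcap {L : ℝ≥0 → ℍ} (h : IsWallTransverseRay T L) {s t : ℝ≥0} (hs : L s ∈ D) (hst : s ≤ t)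
      (ht : L t ∈ w) : ∀ᶠ v in atTop, L v ∈ discCap u (1 - η) :=
    (h.eventually_mem_discCap hw hu hwu hst ht
      (by linarith [hDρ _ hs, min_le_right η ((1 - ρ) / 2)])).mono
      fun _ hv ↦ discCap_subset_discCap u (by linarith [min_le_left η ((1 - ρ) / 2)]) hv
  exact ⟨ξ₁, ξ₂, hξ₁, hξ₂, hangle u L₁ L₂ ξ₁ ξ₂ hu hξ₁ hξ₂ (hcap h₁ hs₁ hst₁ ht₁)
    (hcap h₂ hs₂ hst₂ ht₂)⟩

theorem mainTheorem4 (Γ : Subgroup (Matrix.SpecialLinearGroup (Fin 2) ℝ))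
    (hΓ : IsClosedSurfaceGroup Γ)
    (T : OneVertexTriangulation (HypSurface Γ)) (hT : T.EdgesEssential)
    (D : Set ℍ) (hD : IsBoundedFundamentalDomain Γ D) (ε : ℝ) (hε : 0 < ε) :
    ∃ K : Set ℍ, IsCompact K ∧
      ∀ L₁ L₂ : ℝ≥0 → ℍ, IsWallTransverseRay T L₁ → IsWallTransverseRay T L₂ →
        ∀ s₁ s₂ : ℝ≥0, L₁ s₁ ∈ D → L₂ s₂ ∈ D →
          (∀ w ∈ walls T, (w ∩ K).Nonempty →
            ((∃ t, s₁ ≤ t ∧ L₁ t ∈ w) ↔ (∃ t, s₂ ≤ t ∧ L₂ t ∈ w))) →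
          ∃ ξ₁ ξ₂ : Circle, HasEndpoint L₁ ξ₁ ∧ HasEndpoint L₂ ξ₂ ∧ angularDist ξ₁ ξ₂ ≤ ε := by
  obtain ⟨K, hK, hrays⟩ := mainTheorem4_general hΓ T hD.bounded hε
  exact ⟨K, hK, fun L₁ L₂ h₁ h₂ s₁ s₂ hs₁ hs₂ hwalls ↦
    hrays L₁ L₂ h₁ h₂ s₁ s₂ hs₁ hs₂ fun w hw hwK ↦ (hwalls w hw hwK).1⟩
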